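/- Let $\mathrm U(d)$ be the group of $d\times d$ unitary matrices with normalised Haar measure $dV$, let $\mathbb P(\mathbb C^d)=\{|v\rangle\langle v| : v\in\mathbb C^d,\ \langle v|v\rangle=1\}$ carry the distribution of $V\phi_0V^\dagger$ with $V$ Haar distributed and $\phi_0$ a fixed pure state, and let $\mathrm{PU}(d)=\{V^*\otimes V : V\in \mathrm U(d)\}$ (with $V^*$ the entrywise complex conjugate) carry the distribution of $V^*\otimes V$ with $V$ Haar distributed; call these the uniform distributions. Let $(U(t))_{t\ge 0}$ be a (measurable) family of unitaries in $\mathrm U(d)$, such as the evolution operators of a time-dependent Hamiltonian or of a circuit, and for $\psi\in\mathbb P(\mathbb C^d)$ put $\psi(t)=U(t)\psi U(t)^\dagger$. For $k\in\mathbb N$ the evolution is called - Hilbert-space $k$-ergodic ($k$-HSE) if for every $\psi\in\mathbb P(\mathbb C^d)$ the limit $\lim_{T\to\infty}\frac1T\int_0^T \psi(t)^{\otimes k}\,dt$ exists and equals $\mathbb E_\phi[\phi^{\otimes k}]$, with $\phi$ uniform on $\mathbb P(\mathbb C^d)$; - unitary $k$-ergodic ($k$-UE) if the limit $\lim_{T\to\infty}\frac1T\int_0^T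 (U(t)^*\otimes U(t))^{\otimes k}\,dt$ exists and equals $\int (V^*\otimes V)^{\otimes k}\,dV$; - completely Hilbert-space ergodic (CHSE) if for every $\psi\in\mathbb P(\mathbb C^d)$ the probability measures $\frac1T\int_0^T\delta_{\psi(t)}\,dt$ converge weakly, as $T\to\infty$, to the uniform distribution on $\mathbb P(\mathbb C^d)$; - completely unitary ergodic (CUE) if the probability measures $\frac1T\int_0^T\delta_{U(t)^*\otimes U(t)}\,dt$ converge weakly, as $T\to\infty$, to the uniform distribution on $\mathrm{PU}(d)$. Let $d=2$. Then: 1. for every $k\in\mathbb N$, the evolution is $k$-HSE if and only if it is $k$-UE; 2. it is $k$-HSE for all $k\in\mathbb N$ if and only if it is $k$-UE for all $k\in\mathbb N$; 3. it is CHSE if and only if it is CUE. -/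

import Mathlib

open scoped Matrix Kronecker BoundedContinuousFunction
open MeasureTheory Filter Topology

noncomputable section

namespace QErgodic

/-- The unitary group `U(d)`, with the topology inherited from `d × d` complex matrices. -/
abbrev U (d : ℕ) : Type := Matrix.unitaryGroup (Fin d) ℂ

instance instCompactSpaceU (d : ℕ) : CompactSpace (U d) := by
  have hc : IsClosed {A : Matrix (Fin d) (Fin d) ℂ | A ∈ Matrix.unitaryGroup (Fin d) ℂ} := by
    simp only [Matrix.mem_unitaryGroup_iff]
    exact isClosed_eq (by fun_prop) continuous_const
  have hK : IsCompact {A : Matrix (Fin d) (Fin d) ℂ |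
      ∀ i, A i ∈ {v : Fin d → ℂ | ∀ j, v j ∈ Metric.closedBall (0 : ℂ) 1}} :=
    isCompact_pi_infinite fun _ => isCompact_pi_infinite fun _ => isCompact_closedBall 0 1
  refine isCompact_iff_compactSpace.mp (hK.of_isClosed_subset hc ?_)
  intro A hA i j
  simpa using entry_norm_bound_of_unitary hA i j

instance instMeasurableSpaceU (d : ℕ) : MeasurableSpace (U d) := borel (U d)

instance instBorelSpaceU (d : ℕ) : BorelSpace (U d) := ⟨rfl⟩

/-- The Haar probability measure on `U(d)`, normalised so that the whole group has mass one. -/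
def haarU (d : ℕ) : Measure (U d) := Measure.haarMeasure ⊤

/-- The projective Hilbert space `ℙ(ℂᵈ)`: the density matrices `|v⟩⟨v|` of unit vectors `v`. -/
abbrev PureState (d : ℕ) : Type :=
  {ρ : Matrix (Fin d) (Fin d) ℂ //
    ∃ v : Fin d → ℂ, v ⬝ᵥ star v = 1 ∧ ρ = Matrix.vecMulVec v (star v)}

instance instMeasurableSpacePureState (d : ℕ) : MeasurableSpace (PureState d) :=
  borel (PureState d)

instance instBorelSpacePureState (d : ℕ) : BorelSpace (PureState d) := ⟨rfl⟩

/-- The evolved state `V ψ V†`. -/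
def evolve {d : ℕ} (V : U d) (ψ : PureState d) : PureState d :=
  ⟨(V : Matrix (Fin d) (Fin d) ℂ) * ψ.1 * (V : Matrix (Fin d) (Fin d) ℂ)ᴴ, by
    obtain ⟨v, hv, hψ⟩ := ψ.2
    refine ⟨(V : Matrix (Fin d) (Fin d) ℂ) *ᵥ v, ?_, ?_⟩
    · have hV : (V : Matrix (Fin d) (Fin d) ℂ)ᴴ * (V : Matrix (Fin d) (Fin d) ℂ) = 1 :=
        Matrix.mem_unitaryGroup_iff'.mp V.2
      rw [Matrix.star_mulVec, dotProduct_comm, ← Matrix.dotProduct_mulVec,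
        Matrix.mulVec_mulVec, hV, Matrix.one_mulVec, dotProduct_comm, hv]
    · rw [hψ, Matrix.mul_vecMulVec, Matrix.vecMulVec_mul, Matrix.star_mulVec]⟩

/-- The reference state `|0⟩⟨0|`. -/
def refState (d : ℕ) [NeZero d] : PureState d :=
  ⟨Matrix.vecMulVec (Pi.single 0 1) (star (Pi.single 0 1)), Pi.single 0 1, by simp, rfl⟩

/-- The uniform (Haar) distribution on `ℙ(ℂᵈ)`: the law of `V φ₀ V†` with `V` Haar distributed.
By invariance it does not depend on the reference state `φ₀`. -/
def haarState (d : ℕ) [NeZero d] : Measure (PureState d) :=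
  (haarU d).map fun V => evolve V (refState d)

/-- The vectorised unitary channel `V* ⊗ V`, with `V*` the entrywise complex conjugate. -/
def channel {d : ℕ} (V : U d) : Matrix (Fin d × Fin d) (Fin d × Fin d) ℂ :=
  (V : Matrix (Fin d) (Fin d) ℂ).map star ⊗ₖ (V : Matrix (Fin d) (Fin d) ℂ)

/-- The projective unitary group `PU(d) = {V* ⊗ V : V ∈ U(d)}`, as a space of matrices. -/
abbrev PU (d : ℕ) : Type :=
  {W : Matrix (Fin d × Fin d) (Fin d × Fin d) ℂ // ∃ V : U d, W = channel V}

instance instMeasurableSpacePU (d : ℕ) : MeasurableSpace (PU d) := borel (PU d)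

instance instBorelSpacePU (d : ℕ) : BorelSpace (PU d) := ⟨rfl⟩

/-- The projection `U(d) → PU(d)`. -/
def toPU {d : ℕ} (V : U d) : PU d := ⟨channel V, V, rfl⟩

/-- The uniform (Haar) distribution on `PU(d)`: the law of `V* ⊗ V` with `V` Haar distributed. -/
def haarPU (d : ℕ) : Measure (PU d) := (haarU d).map toPU

/-- The `k`-fold tensor (Kronecker) power `A^{⊗k}`, its rows and columns indexed by `k`-tuples. -/
def tensorPow {n : Type} (k : ℕ) (A : Matrix n n ℂ) : Matrix (Fin k → n) (Fin k → n) ℂ :=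
  Matrix.of fun i j => ∏ a, A (i a) (j a)

/-- The time average `(1/T) ∫₀ᵀ F(t) dt` of a matrix-valued function, entry by entry. -/
def timeAverage {n : Type} (F : ℝ → Matrix n n ℂ) (T : ℝ) : Matrix n n ℂ :=
  Matrix.of fun i j => (T : ℂ)⁻¹ * ∫ t in (0 : ℝ)..T, F t i j

/-- The average of a matrix-valued function against a measure, entry by entry. -/
def spaceAverage {X n : Type} [MeasurableSpace X] (μ : Measure X) (F : X → Matrix n n ℂ) :
    Matrix n n ℂ :=
  Matrix.of fun i j => ∫ x, F x i j ∂μ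

/-- Hilbert-space `k`-ergodicity of the evolution `V t`, `t ≥ 0`: for every initial state `ψ`, the
limit of the time averages of `ψ(t)^{⊗k}` exists and is the `k`-th moment of the uniform
distribution on `ℙ(ℂᵈ)`. -/
def HSE {d : ℕ} [NeZero d] (k : ℕ) (V : ℝ → U d) : Prop :=
  ∀ ψ : PureState d,
    Tendsto (timeAverage fun t => tensorPow k (evolve (V t) ψ).1) atTop
      (𝓝 (spaceAverage (haarState d) fun φ => tensorPow k φ.1))

/-- Unitary `k`-ergodicity of the evolution `V t`, `t ≥ 0`: the limit of the time averages of
`(V(t)* ⊗ V(t))^{⊗k}` exists and is the `k`-th moment of the Haar distribution. -/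
def UE {d : ℕ} (k : ℕ) (V : ℝ → U d) : Prop :=
  Tendsto (timeAverage fun t => tensorPow k (toPU (V t)).1) atTop
    (𝓝 (spaceAverage (haarPU d) fun W => tensorPow k W.1))

/-- The temporal ensemble `lim_{T → ∞} (1/T) ∫₀ᵀ δ_{x(t)} dt` exists, as a weak limit of measures,
and equals `μ`. -/
def TemporalEnsembleIs {X : Type} [TopologicalSpace X] [MeasurableSpace X] (x : ℝ → X)
    (μ : Measure X) : Prop :=
  ∀ f : X →ᵇ ℝ, Tendsto (fun T : ℝ => T⁻¹ * ∫ t in (0 : ℝ)..T, f (x t)) atTop (𝓝 (∫ y, f y ∂μ))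

/-- Complete Hilbert-space ergodicity: for every initial state, the temporal ensemble of states
has the uniform distribution on `ℙ(ℂᵈ)`. -/
def CHSE {d : ℕ} [NeZero d] (V : ℝ → U d) : Prop :=
  ∀ ψ : PureState d, TemporalEnsembleIs (fun t => evolve (V t) ψ) (haarState d)

/-- Complete unitary ergodicity: the temporal ensemble of the unitary channels has the Haar
distribution on `PU(d)`. -/
def CUE {d : ℕ} (V : ℝ → U d) : Prop :=
  TemporalEnsembleIs (fun t => toPU (V t)) (haarPU d)

end QErgodic

end

noncomputable section

namespace QErgodic

/-! The continuous functions on `U d` whose time averages converge to their Haar average form a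
closed subspace S, `equidistributed V hV`. Each notion of ergodicity says that a family of functions
lies in S: entries of `(WψW†)^{⊗k}` or `(W*⊗W)^{⊗k}`, or pullbacks of continuous functions from the
state space or from `PU d`. States depend linearly and continuously on the channel, so the unitary
notions imply the state ones.

For the converse at d = 2, let A, B, C, D be the entries of W and δ = AD - BC. Since W† = adj(W)/δ,
every channel moment is a scalar times a degree 2k monomial over δᵏ. Evolving the state along (1, z)
gives polynomials in z and its conjugate with values in S, and polarization makes the conjugate an
independent variable w. At w = -1/z the conjugated rows become multiples of the rows themselves, so
the coefficients of (A+Bz)ᵐ(C+Dz)ⁿ/δᵏ, m+n = 2k, lie in S (`coeff_mem_of_stateProduct_mem`). Each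
coefficient is a positive combination of monomials with equal row and column weights. These agree up
to multiples of δ, that is, up to lower-degree terms, which a partial trace and induction place in S
(`monomial_mem_of_stateProduct_mem`).

For the complete notions, CHSE gives every k-HSE, hence every k-UE, and Stone–Weierstrass on `PU d`
gives CUE. -/

/-! ### Haar averages and the space of equidistributed functions -/

instance isHaarMeasure_haarU (d : ℕ) : (haarU d).IsHaarMeasure := by
  unfold haarU; infer_instance

instance isProbabilityMeasure_haarU (d : ℕ) : IsProbabilityMeasure (haarU d) :=
  ⟨by simpa [haarU] using Measure.haarMeasure_self (K₀ := (⊤ : TopologicalSpace.PositiveCompacts (U d)))⟩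

/-- A right translate of Haar measure is again a left-invariant probability measure, so uniqueness
applies. -/
theorem haarU_map_mul_right (d : ℕ) (g : U d) : (haarU d).map (· * g) = haarU d := by
  have : IsProbabilityMeasure ((haarU d).map (· * g)) :=
    Measure.isProbabilityMeasure_map (continuous_mul_const g).measurable.aemeasurable
  exact Measure.isHaarMeasure_eq_of_isProbabilityMeasure _ _

theorem integrable_haarU {d : ℕ} (f : C(U d, ℂ)) : Integrable f (haarU d) :=
  f.continuous.integrable_of_hasCompactSupport (HasCompactSupport.of_compactSpace f)

theorem intervalIntegrable_comp_evolution {d : ℕ} {V : ℝ → U d}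
    (hV : AEMeasurable V (volume.restrict (Set.Ici (0 : ℝ)))) (f : C(U d, ℂ)) {T : ℝ}
    (hT : 0 ≤ T) : IntervalIntegrable (fun t => f (V t)) volume 0 T := by
  rw [intervalIntegrable_iff, Set.uIoc_of_le hT]
  have hV' : AEMeasurable V (volume.restrict (Set.Ioc 0 T)) :=
    hV.mono_measure (Measure.restrict_mono (fun t ht => ht.1.le) le_rfl)
  exact Integrable.of_bound (f.continuous.measurable.comp_aemeasurable hV').aestronglyMeasurable
    ‖f‖ (Eventually.of_forall fun t => f.norm_coe_le_norm _)

/-- The continuous functions on `U(d)` whose time averages along `V` converge to their Haar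
average. -/
def equidistributed {d : ℕ} (V : ℝ → U d)
    (hV : AEMeasurable V (volume.restrict (Set.Ici (0 : ℝ)))) : Submodule ℂ C(U d, ℂ) where
  carrier := {f | Tendsto (fun T : ℝ => (T : ℂ)⁻¹ * ∫ t in (0 : ℝ)..T, f (V t)) atTop
    (𝓝 (∫ W, f W ∂haarU d))}
  zero_mem' := by simp
  add_mem' := by
    intro f g hf hg
    simp only [Set.mem_ofPred_eq, ContinuousMap.add_apply] at hf hg ⊢
    rw [integral_add (integrable_haarU f) (integrable_haarU g)]
    refine (hf.add hg).congr' ?_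
    filter_upwards [eventually_ge_atTop 0] with T hT
    rw [intervalIntegral.integral_add (intervalIntegrable_comp_evolution hV f hT)
      (intervalIntegrable_comp_evolution hV g hT), mul_add]
  smul_mem' := by
    intro c f hf
    simp only [Set.mem_ofPred_eq, ContinuousMap.smul_apply, smul_eq_mul] at hf ⊢
    rw [integral_const_mul]
    refine (hf.const_mul c).congr fun T => ?_
    rw [intervalIntegral.integral_const_mul]
    ring

section

variable {d : ℕ} {V : ℝ → U d} {hV : AEMeasurable V (volume.restrict (Set.Ici (0 : ℝ)))}

theorem mem_equidistributed {f : C(U d, ℂ)} : f ∈ equidistributed V hV ↔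
    Tendsto (fun T : ℝ => (T : ℂ)⁻¹ * ∫ t in (0 : ℝ)..T, f (V t)) atTop
      (𝓝 (∫ W, f W ∂haarU d)) := Iff.rfl

/-- Time averages and the Haar average are both contractions for the sup norm, so a three-term
estimate passes to limits. -/
theorem isClosed_equidistributed : IsClosed (equidistributed V hV : Set C(U d, ℂ)) := by
  refine isClosed_of_closure_subset fun f hf => ?_
  rw [SetLike.mem_coe, mem_equidistributed, Metric.tendsto_atTop]
  intro ε hε
  obtain ⟨g, hg, hfg⟩ := Metric.mem_closure_iff.1 hf (ε / 4) (by positivity)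
  rw [SetLike.mem_coe, mem_equidistributed, Metric.tendsto_atTop] at hg
  obtain ⟨N, hN⟩ := hg (ε / 4) (by positivity)
  have hle : ∀ W, ‖f W - g W‖ ≤ ε / 4 := fun W => by
    rw [← dist_eq_norm]; exact (ContinuousMap.dist_apply_le_dist W).trans hfg.le
  refine ⟨max N 1, fun T hT => ?_⟩
  have hT1 : 1 ≤ T := (le_max_right _ _).trans hT
  have hT0 : 0 < T := by linarith
  have h1 : ‖(T : ℂ)⁻¹ * (∫ t in (0 : ℝ)..T, f (V t)) - (T : ℂ)⁻¹ * ∫ t in (0 : ℝ)..T, g (V t)‖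
      ≤ ε / 4 := by
    rw [← mul_sub, ← intervalIntegral.integral_sub (intervalIntegrable_comp_evolution hV f hT0.le)
      (intervalIntegrable_comp_evolution hV g hT0.le), norm_mul, norm_inv, Complex.norm_real,
      Real.norm_of_nonneg hT0.le]
    have := intervalIntegral.norm_integral_le_of_norm_le_const
      (f := fun t => f (V t) - g (V t)) (a := 0) (b := T) fun t _ => hle (V t)
    rw [sub_zero, abs_of_pos hT0] at this
    rw [inv_mul_le_iff₀ hT0]
    linarith
  have h2 : ‖(∫ W, g W ∂haarU d) - ∫ W, f W ∂haarU d‖ ≤ ε / 4 := by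
    rw [← integral_sub (integrable_haarU g) (integrable_haarU f)]
    have := norm_integral_le_of_norm_le_const (μ := haarU d) (f := fun W => g W - f W)
      (C := ε / 4) (Eventually.of_forall fun W => by rw [norm_sub_rev]; exact hle W)
    simpa using this
  have h3 := hN T ((le_max_left _ _).trans hT)
  rw [← dist_eq_norm] at h1 h2
  have := dist_triangle4 ((T : ℂ)⁻¹ * ∫ t in (0 : ℝ)..T, f (V t))
    ((T : ℂ)⁻¹ * ∫ t in (0 : ℝ)..T, g (V t)) (∫ W, g W ∂haarU d) (∫ W, f W ∂haarU d)
  linarith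

theorem ofReal_comp_mem_equidistributed (f : C(U d, ℝ)) :
    (⟨fun W => (f W : ℂ), by fun_prop⟩ : C(U d, ℂ)) ∈ equidistributed V hV ↔
    Tendsto (fun T : ℝ => T⁻¹ * ∫ t in (0 : ℝ)..T, f (V t)) atTop (𝓝 (∫ W, f W ∂haarU d)) := by
  rw [mem_equidistributed]
  simp only [ContinuousMap.coe_mk, intervalIntegral.integral_ofReal, integral_complex_ofReal]
  rw [← Filter.tendsto_ofReal_iff]
  simp

/-- The temporal ensemble of the image of `V` under a continuous map `π` is the image of the Haar
measure exactly when all continuous functions of `π` are equidistributed. -/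
theorem temporalEnsembleIs_map_iff {X : Type} [TopologicalSpace X] [CompactSpace X]
    [MeasurableSpace X] [BorelSpace X] (π : C(U d, X)) :
    TemporalEnsembleIs (fun t => π (V t)) ((haarU d).map π) ↔
      ∀ f : C(X, ℂ), f.comp π ∈ equidistributed V hV := by
  have hmap (f : C(X, ℝ)) : ∫ y, f y ∂(haarU d).map π = ∫ W, f (π W) ∂haarU d :=
    integral_map π.continuous.measurable.aemeasurable
      (f.continuous.stronglyMeasurable_of_hasCompactSupport
        (HasCompactSupport.of_compactSpace f)).aestronglyMeasurable
  constructor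
  · intro h f
    have hR (g : C(X, ℝ)) :
        (⟨fun W => (g (π W) : ℂ), by fun_prop⟩ : C(U d, ℂ)) ∈ equidistributed V hV := by
      refine (ofReal_comp_mem_equidistributed (g.comp π)).2 ?_
      have := h (BoundedContinuousFunction.mkOfCompact g)
      simp only [BoundedContinuousFunction.mkOfCompact_apply, hmap] at this
      exact this
    have hre := hR ⟨fun x => (f x).re, by fun_prop⟩
    have him := hR ⟨fun x => (f x).im, by fun_prop⟩
    convert add_mem hre (Submodule.smul_mem _ Complex.I him) using 1
    ext W
    simp [mul_comm Complex.I]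
  · intro h f
    have := h ⟨fun x => (f x : ℂ), by fun_prop⟩
    have := (ofReal_comp_mem_equidistributed (hV := hV) (f.toContinuousMap.comp π)).1 this
    have h2 := hmap f.toContinuousMap
    simp only [BoundedContinuousFunction.coe_toContinuousMap] at h2
    rw [h2]
    exact this

theorem tendsto_timeAverage_iff {n : Type} {X : Type} [TopologicalSpace X] [MeasurableSpace X]
    [BorelSpace X] (π : C(U d, X)) (F : X → Matrix n n ℂ) (hF : ∀ i j, Continuous fun x => F x i j) :
    Tendsto (timeAverage fun t => F (π (V t))) atTop
      (𝓝 (spaceAverage ((haarU d).map π) F)) ↔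
    ∀ i j, (⟨fun W => F (π W) i j, (hF i j).comp π.continuous⟩ : C(U d, ℂ)) ∈
      equidistributed V hV := by
  refine tendsto_pi_nhds.trans <| forall_congr' fun i =>
    tendsto_pi_nhds.trans <| forall_congr' fun j => ?_
  rw [mem_equidistributed]
  simp only [timeAverage, spaceAverage, Matrix.of_apply, ContinuousMap.coe_mk]
  rw [integral_map π.continuous.measurable.aemeasurable
    (hF i j).measurable.aestronglyMeasurable]

end

/-! ### Polarization and monomials in the entries of a 2 × 2 matrix -/

section Polarization

open Polynomial

/-- The coefficients of `(A + Bz)ᵐ (C + Dz)ⁿ`. -/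
theorem coeff_linear_pow_mul_linear_pow {R : Type*} [CommRing R] (A B C D : R) (m n j : ℕ) :
    ((Polynomial.C A + Polynomial.C B * X) ^ m * (Polynomial.C C + Polynomial.C D * X) ^ n).coeff j
      = ∑ x ∈ Finset.HasAntidiagonal.antidiagonal j, ((m.choose x.1 * n.choose x.2 : ℕ) : R) *
        (A ^ (m - x.1) * B ^ x.1 * C ^ (n - x.2) * D ^ x.2) := by
  have hlin (a b : R) (m i : ℕ) : ((Polynomial.C a + Polynomial.C b * X) ^ m).coeff i =
      (m.choose i : R) * (a ^ (m - i) * b ^ i) := by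
    have hterm : ∀ x ∈ Finset.range (m + 1), ((Polynomial.C b * X) ^ x * Polynomial.C a ^ (m - x) *
        (m.choose x : R[X])).coeff i = if i = x then (m.choose i : R) * (a ^ (m - i) * b ^ i)
          else 0 := by
      intro x _
      rw [show (Polynomial.C b * X) ^ x * Polynomial.C a ^ (m - x) * (m.choose x : R[X]) =
        Polynomial.C ((m.choose x : R) * (a ^ (m - x) * b ^ x)) * X ^ x by
          simp only [map_mul, map_pow, map_natCast]; ring, coeff_C_mul_X_pow]
      split_ifs with h
      · rw [h]
      · rfl
    rw [add_comm, add_pow, finsetSum_coeff, Finset.sum_congr rfl hterm, Finset.sum_ite_eq]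
    split_ifs with h
    · rfl
    · rw [Nat.choose_eq_zero_of_lt (by simpa [Nat.lt_succ_iff] using h), Nat.cast_zero, zero_mul]
  rw [coeff_mul]
  refine Finset.sum_congr rfl fun x _ => ?_
  rw [hlin, hlin]
  push_cast
  ring

variable {R : Type*} [CommRing R] [Algebra ℂ R] (S : Submodule ℂ R)

/-- If a polynomial takes values in a subspace at infinitely many scalars, its coefficients lie in
that subspace. -/
theorem coeff_mem_of_infinite_eval_mem (P : R[X]) {s : Set ℂ} (hs : s.Infinite)
    (h : ∀ z ∈ s, P.eval (algebraMap ℂ R z) ∈ S) (n : ℕ) : P.coeff n ∈ S := by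
  by_contra hn
  -- A functional killing S but not the coefficient reduces the claim to a scalar polynomial with
  -- infinitely many roots.
  obtain ⟨φ, hφ, hS⟩ := Submodule.exists_le_ker_of_notMem hn
  set q : ℂ[X] := ∑ i ∈ Finset.range (P.natDegree + 1), monomial i (φ (P.coeff i)) with hq
  have hq0 : q = 0 := by
    refine Polynomial.eq_zero_of_infinite_isRoot q (hs.mono fun z hz => ?_)
    have h0 : φ (P.eval (algebraMap ℂ R z)) = 0 := hS (h z hz)
    rw [Polynomial.eval_eq_sum_range, map_sum] at h0
    simp only [Set.mem_ofPred_eq, IsRoot.def, hq, eval_finsetSum, eval_monomial]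
    rw [← h0]
    refine Finset.sum_congr rfl fun i _ => ?_
    rw [← map_pow, ← Algebra.commutes, ← Algebra.smul_def, map_smul, smul_eq_mul, mul_comm]
  have hc : q.coeff n = φ (P.coeff n) := by
    simp only [hq, finsetSum_coeff, coeff_monomial, Finset.sum_ite_eq', Finset.mem_range]
    split_ifs with hlt
    · rfl
    · rw [coeff_eq_zero_of_natDegree_lt (by omega), map_zero]
  exact hφ (by rw [← hc, hq0, coeff_zero])

theorem eval_mem_of_infinite_eval_mem (P : R[X]) {s : Set ℂ} (hs : s.Infinite)
    (h : ∀ z ∈ s, P.eval (algebraMap ℂ R z) ∈ S) (z : ℂ) : P.eval (algebraMap ℂ R z) ∈ S := by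
  rw [Polynomial.eval_eq_sum_range]
  refine Submodule.sum_mem _ fun i _ => ?_
  rw [← map_pow, ← Algebra.commutes, ← Algebra.smul_def]
  exact S.smul_mem _ (coeff_mem_of_infinite_eval_mem S P hs h i)

theorem infinite_range_ofReal : (Set.range ((↑) : ℝ → ℂ)).Infinite :=
  Set.infinite_range_of_injective Complex.ofReal_injective

/-- The product `(v₀A + v₁B)ᵖ (v₀C + v₁D)^q (w₀A' + w₁B')ʳ (w₀C' + w₁D')ˢ`, with `v, w` scalars. -/
def stateProduct (A B C D A' B' C' D' : R) (p q r s : ℕ) (v₀ v₁ w₀ w₁ : ℂ) : R :=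
  (algebraMap ℂ R v₀ * A + algebraMap ℂ R v₁ * B) ^ p *
    (algebraMap ℂ R v₀ * C + algebraMap ℂ R v₁ * D) ^ q *
    ((algebraMap ℂ R w₀ * A' + algebraMap ℂ R w₁ * B') ^ r *
    (algebraMap ℂ R w₀ * C' + algebraMap ℂ R w₁ * D') ^ s)

/-- Polarization: membership for conjugate arguments implies it for independent arguments. -/
theorem stateProduct_mem_of_conj_mem {A B C D A' B' C' D' : R} {p q r s : ℕ}
    (h : ∀ z : ℂ, stateProduct A B C D A' B' C' D' p q r s 1 z 1 (star z) ∈ S) (z w : ℂ) :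
    stateProduct A B C D A' B' C' D' p q r s 1 z 1 w ∈ S := by
  -- For real x and y the two arguments x ± iy are conjugate. The real variables are freed one at a
  -- time: x in `hreal`, then y.
  have key : ∀ x y : ℂ, stateProduct A B C D A' B' C' D' p q r s 1
      (x + Complex.I * y) 1 (x - Complex.I * y) ∈ S := by
    have hreal : ∀ (x : ℂ) (y : ℝ), stateProduct A B C D A' B' C' D' p q r s 1
        (x + Complex.I * y) 1 (x - Complex.I * y) ∈ S := by
      intro x y
      let a : R := algebraMap ℂ R (Complex.I * y)
      let P : R[X] := (Polynomial.C A + (X + Polynomial.C a) * Polynomial.C B) ^ p *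
        (Polynomial.C C + (X + Polynomial.C a) * Polynomial.C D) ^ q *
        ((Polynomial.C A' + (X - Polynomial.C a) * Polynomial.C B') ^ r *
        (Polynomial.C C' + (X - Polynomial.C a) * Polynomial.C D') ^ s)
      have hP : ∀ u : ℂ, P.eval (algebraMap ℂ R u) = stateProduct A B C D A' B' C' D' p q r s 1
          (u + Complex.I * y) 1 (u - Complex.I * y) := by
        intro u
        simp only [P, a, stateProduct, eval_mul, eval_pow, eval_add, eval_sub, eval_C, eval_X,
          map_one, one_mul, map_add, map_sub]
      rw [← hP]
      refine eval_mem_of_infinite_eval_mem S P infinite_range_ofReal ?_ x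
      rintro _ ⟨u, rfl⟩
      rw [hP]
      convert h (u + Complex.I * y) using 2
      simp [sub_eq_add_neg]
    intro x y
    let a : R := algebraMap ℂ R x
    let b : R := algebraMap ℂ R Complex.I
    let P : R[X] := (Polynomial.C A + (Polynomial.C a + Polynomial.C b * X) * Polynomial.C B) ^ p *
      (Polynomial.C C + (Polynomial.C a + Polynomial.C b * X) * Polynomial.C D) ^ q *
      ((Polynomial.C A' + (Polynomial.C a - Polynomial.C b * X) * Polynomial.C B') ^ r *
      (Polynomial.C C' + (Polynomial.C a - Polynomial.C b * X) * Polynomial.C D') ^ s)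
    have hP : ∀ u : ℂ, P.eval (algebraMap ℂ R u) = stateProduct A B C D A' B' C' D' p q r s 1
        (x + Complex.I * u) 1 (x - Complex.I * u) := by
      intro u
      simp only [P, a, b, stateProduct, eval_mul, eval_pow, eval_add, eval_sub, eval_C, eval_X,
        map_one, one_mul, map_add, map_sub, map_mul]
    rw [← hP]
    refine eval_mem_of_infinite_eval_mem S P infinite_range_ofReal ?_ y
    rintro _ ⟨u, rfl⟩
    rw [hP]
    exact hreal x u
  have hI : Complex.I * ((z - w) / (2 * Complex.I)) = (z - w) / 2 := by
    field_simp
  -- These values solve x + iy = z and x - iy = w.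
  convert key ((z + w) / 2) ((z - w) / (2 * Complex.I)) using 2 <;> rw [hI] <;> ring

variable {A B C D δ δ' : R} {S}

/-- Modulo `S`, monomials of degree `2(l+1)` with the same row and column weights agree, once `S`
contains the monomials of degree `2l`. -/
theorem monomial_sub_monomial_mem (hδ : A * D - B * C = δ) (hδ' : δ * δ' = 1) {l : ℕ}
    (ih : ∀ a b c d, a + b + c + d = 2 * l → A ^ a * B ^ b * C ^ c * D ^ d * δ' ^ l ∈ S)
    (t a b c d : ℕ) (h : a + b + c + d + 2 * t = 2 * (l + 1)) :
    A ^ (a + t) * B ^ b * C ^ c * D ^ (d + t) * δ' ^ (l + 1) -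
      A ^ a * B ^ (b + t) * C ^ (c + t) * D ^ d * δ' ^ (l + 1) ∈ S := by
  induction t generalizing a b c d with
  | zero => simp
  | succ t IH =>
    have h1 := IH (a + 1) b c (d + 1) (by omega)
    have h2 := ih a (b + t) (c + t) d (by omega)
    -- Trading one AD for BC costs a factor δ, which cancels one δ' and leaves a monomial of degree
    -- 2l.
    have h3 : A ^ (a + 1) * B ^ (b + t) * C ^ (c + t) * D ^ (d + 1) * δ' ^ (l + 1) -
        A ^ a * B ^ (b + (t + 1)) * C ^ (c + (t + 1)) * D ^ d * δ' ^ (l + 1) =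
        A ^ a * B ^ (b + t) * C ^ (c + t) * D ^ d * δ' ^ l := by
      calc _ = A ^ a * B ^ (b + t) * C ^ (c + t) * D ^ d * δ' ^ l * ((A * D - B * C) * δ') := by
            ring
        _ = _ := by rw [hδ, hδ', mul_one]
    have h4 := add_mem h1 (h3 ▸ h2)
    convert h4 using 1
    rw [show a + 1 + t = a + (t + 1) by ring, show d + 1 + t = d + (t + 1) by ring]
    ring

/-- Two 2 × 2 exponent tables with the same margins differ by a multiple of (1, -1, -1, 1), so
repeated trades of AD for BC connect them. -/
theorem monomial_sub_monomial_mem_of_weights (hδ : A * D - B * C = δ) (hδ' : δ * δ' = 1) {l : ℕ}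
    (ih : ∀ a b c d, a + b + c + d = 2 * l → A ^ a * B ^ b * C ^ c * D ^ d * δ' ^ l ∈ S)
    {a b c d a' b' c' d' : ℕ} (h : a + b + c + d = 2 * (l + 1)) (hrow : a + b = a' + b')
    (hrow' : c + d = c' + d') (hcol : b + d = b' + d') :
    A ^ a * B ^ b * C ^ c * D ^ d * δ' ^ (l + 1) -
      A ^ a' * B ^ b' * C ^ c' * D ^ d' * δ' ^ (l + 1) ∈ S := by
  rcases le_total a' a with hle | hle
  · obtain ⟨t, rfl⟩ := Nat.exists_eq_add_of_le hle
    obtain rfl : b' = b + t := by omega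
    obtain rfl : c' = c + t := by omega
    obtain rfl : d = d' + t := by omega
    exact monomial_sub_monomial_mem hδ hδ' ih t a' b c d' (by omega)
  · obtain ⟨t, rfl⟩ := Nat.exists_eq_add_of_le hle
    obtain rfl : b = b' + t := by omega
    obtain rfl : c = c' + t := by omega
    obtain rfl : d' = d + t := by omega
    rw [← neg_sub]
    exact neg_mem (monomial_sub_monomial_mem hδ hδ' ih t a b' c' d (by omega))

/-- Taking a partial trace, state products of degree `l` lie in `S` if those of degree `l + 1` do. -/
theorem stateProduct_mem_of_succ (hδ : A * D - B * C = δ) (hδ' : δ * δ' = 1) {l : ℕ}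
    (h : ∀ p q r s : ℕ, p + q = l + 1 → r + s = l + 1 → ∀ z : ℂ,
      stateProduct A B C D (D * δ') (-C * δ') (-B * δ') (A * δ') p q r s 1 z 1 (star z) ∈ S)
    (p q r s : ℕ) (hpq : p + q = l) (hrs : r + s = l) (z : ℂ) :
    stateProduct A B C D (D * δ') (-C * δ') (-B * δ') (A * δ') p q r s 1 z 1 (star z) ∈ S := by
  -- 1 + |z|² is the squared norm of (1, z), hence the trace of the unnormalised state.
  have hz : (1 + z * star z : ℂ) ≠ 0 := by
    rw [Complex.star_def, Complex.mul_conj]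
    exact_mod_cast (add_pos_of_pos_of_nonneg one_pos (Complex.normSq_nonneg z)).ne'
  refine (Submodule.smul_mem_iff _ hz).1 ?_
  convert add_mem (h (p + 1) q (r + 1) s (by omega) (by omega) z)
    (h p (q + 1) r (s + 1) (by omega) (by omega) z) using 1
  simp only [Algebra.smul_def, stateProduct, map_add, map_mul, map_one, one_mul, pow_succ]
  set ζ := algebraMap ℂ R z
  set η := algebraMap ℂ R (star z)
  have htr : 1 + ζ * η = (A + ζ * B) * (D * δ' + η * (-C * δ')) +
      (C + ζ * D) * (-B * δ' + η * (A * δ')) := by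
    linear_combination (-(1 + ζ * η)) * hδ' - (1 + ζ * η) * δ' * hδ
  rw [htr]
  ring

/-- If the state products of degree `l` lie in `S`, so do the polynomials
`(A + Bz)ᵐ (C + Dz)ⁿ δ⁻ˡ`, coefficient by coefficient. -/
theorem coeff_mem_of_stateProduct_mem {l : ℕ}
    (h : ∀ p q r s : ℕ, p + q = l → r + s = l → ∀ z : ℂ,
      stateProduct A B C D (D * δ') (-C * δ') (-B * δ') (A * δ') p q r s 1 z 1 (star z) ∈ S) {m n : ℕ} (hmn : m + n = 2 * l) (j : ℕ) :
    ((Polynomial.C A + Polynomial.C B * X) ^ m *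
      (Polynomial.C C + Polynomial.C D * X) ^ n).coeff j * δ' ^ l ∈ S := by
  -- After the substitution below, conjugated row 0 turns into row 1 and vice versa, hence m = p + s
  -- and n = q + r.
  obtain ⟨p, q, r, s, hpq, hrs, rfl, rfl⟩ : ∃ p q r s, p + q = l ∧ r + s = l ∧ m = p + s ∧
      n = q + r := by
    rcases le_total m l with hm | hm
    · exact ⟨m, l - m, l, 0, by omega, by omega, by omega, by omega⟩
    · exact ⟨l, 0, n, l - n, by omega, by omega, by omega, by omega⟩
  rw [← coeff_mul_C]
  refine coeff_mem_of_infinite_eval_mem S _ (s := {0}ᶜ)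
    (Set.Finite.infinite_compl (Set.finite_singleton 0)) ?_ j
  intro z hz
  have hz0 : z ≠ 0 := hz
  have h1 : algebraMap ℂ R z * algebraMap ℂ R (-z⁻¹) = -1 := by
    rw [← map_mul, mul_neg, mul_inv_cancel₀ hz0, map_neg, map_one]
  -- The choice w = -1/z makes the trace factor 1 + zw vanish. The scalar (-1)ˢzˡ then clears signs
  -- and denominators.
  have hp := stateProduct_mem_of_conj_mem S (A := A) (B := B) (C := C) (D := D) (A' := D * δ')
    (B' := -C * δ') (C' := -B * δ') (D' := A * δ') (p := p) (q := q) (r := r) (s := s)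
    (h p q r s hpq hrs) z (-z⁻¹)
  have := S.smul_mem ((-1) ^ s * z ^ l) hp
  convert this using 1
  rw [Algebra.smul_def, stateProduct]
  simp only [eval_mul, eval_pow, eval_add, eval_C, eval_X, map_mul, map_pow, map_one, one_mul,
    map_neg (algebraMap ℂ R) (1 : ℂ)]
  set ζ := algebraMap ℂ R z
  set η := algebraMap ℂ R (-z⁻¹)
  have e1 : ζ * (D * δ' + η * (-C * δ')) = (C + D * ζ) * δ' := by
    linear_combination (-C * δ') * h1
  have e2 : -ζ * (-B * δ' + η * (A * δ')) = (A + B * ζ) * δ' := by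
    linear_combination (-A * δ') * h1
  calc _ = (A + ζ * B) ^ p * (C + ζ * D) ^ q *
        (((C + D * ζ) * δ') ^ r * ((A + B * ζ) * δ') ^ s) := by
        rw [mul_pow, mul_pow _ δ', ← hrs]; ring
    _ = _ := by
        rw [← e1, ← e2, mul_pow, mul_pow (-ζ), neg_pow ζ, ← hrs]; ring

/-- If the state products of degree `k` lie in `S`, then so do all homogeneous monomials of
degree `2k` in `A, B, C, D`, divided by `(AD - BC)ᵏ`. -/
theorem monomial_mem_of_stateProduct_mem (hδ : A * D - B * C = δ) (hδ' : δ * δ' = 1) {k : ℕ}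
    (h : ∀ p q r s : ℕ, p + q = k → r + s = k → ∀ z : ℂ,
      stateProduct A B C D (D * δ') (-C * δ') (-B * δ') (A * δ') p q r s 1 z 1 (star z) ∈ S) {a b c d : ℕ} (habcd : a + b + c + d = 2 * k) :
    A ^ a * B ^ b * C ^ c * D ^ d * δ' ^ k ∈ S := by
  induction k generalizing a b c d with
  | zero =>
    obtain ⟨rfl, rfl, rfl, rfl⟩ : a = 0 ∧ b = 0 ∧ c = 0 ∧ d = 0 := by omega
    simpa [stateProduct] using h 0 0 0 0 rfl rfl 1
  | succ l IH =>
    have ih : ∀ a b c d, a + b + c + d = 2 * l → A ^ a * B ^ b * C ^ c * D ^ d * δ' ^ l ∈ S :=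
      fun a b c d => IH (stateProduct_mem_of_succ hδ hδ' h)
    -- The index b + d is the column weight of the target monomial, so every term of this
    -- coefficient has its weights.
    have hc := coeff_mem_of_stateProduct_mem h (m := a + b) (n := c + d)
      (by omega) (b + d)
    rw [coeff_linear_pow_mul_linear_pow, Finset.sum_mul] at hc
    set M := A ^ a * B ^ b * C ^ c * D ^ d * δ' ^ (l + 1) with hM
    have hdiff : ∑ x ∈ Finset.HasAntidiagonal.antidiagonal (b + d),
        (((a + b).choose x.1 * (c + d).choose x.2 : ℕ) : R) *
          (M - A ^ (a + b - x.1) * B ^ x.1 * C ^ (c + d - x.2) * D ^ x.2 * δ' ^ (l + 1)) ∈ S := by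
      refine Submodule.sum_mem _ fun x hx => ?_
      rw [Finset.HasAntidiagonal.mem_antidiagonal] at hx
      rw [← nsmul_eq_mul]
      -- Outside these ranges the natural subtraction in the exponents truncates, but the binomial
      -- coefficient is zero.
      by_cases h1 : x.1 ≤ a + b
      · by_cases h2 : x.2 ≤ c + d
        · exact nsmul_mem (monomial_sub_monomial_mem_of_weights hδ hδ' ih habcd (by omega)
            (by omega) (by omega)) _
        · rw [Nat.choose_eq_zero_of_lt (not_le.1 h2), mul_zero, zero_smul]
          exact zero_mem _
      · rw [Nat.choose_eq_zero_of_lt (not_le.1 h1), zero_mul, zero_smul]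
        exact zero_mem _
    have hsum := add_mem hdiff hc
    rw [← Finset.sum_add_distrib] at hsum
    -- Vandermonde: the total weight is one binomial coefficient, nonzero and hence invertible in ℂ.
    have hchoose : ∑ x ∈ Finset.HasAntidiagonal.antidiagonal (b + d),
        (((a + b).choose x.1 * (c + d).choose x.2 : ℕ) : R) * M =
        (((a + b + (c + d)).choose (b + d) : ℕ) : R) * M := by
      rw [Nat.add_choose_eq, Nat.cast_sum, Finset.sum_mul]
    have hmem : (((a + b + (c + d)).choose (b + d) : ℕ) : ℂ) • M ∈ S := by
      rw [Algebra.smul_def, map_natCast, ← hchoose]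
      convert hsum using 2 with x
      ring
    have hne : (((a + b + (c + d)).choose (b + d) : ℕ) : ℂ) ≠ 0 :=
      Nat.cast_ne_zero.2 (Nat.choose_pos (by omega)).ne'
    exact (Submodule.smul_mem_iff _ hne).1 hmem

end Polarization

/-! ### Orbit maps, channels and their moments -/

/-- A matrix entry as a continuous function on the unitary group. -/
def entry {d : ℕ} (i j : Fin d) : C(U d, ℂ) :=
  ⟨fun W => (W : Matrix (Fin d) (Fin d) ℂ) i j, continuous_subtype_val.matrix_elem i j⟩

/-- The orbit map `W ↦ W ψ W†`. -/
def evolveMap {d : ℕ} (ψ : PureState d) : C(U d, PureState d) :=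
  ⟨fun W => evolve W ψ, by unfold evolve; fun_prop⟩

theorem continuous_channel {d : ℕ} : Continuous (channel : U d → _) := by
  refine continuous_matrix fun i j => ?_
  exact (continuous_subtype_val.matrix_elem i.1 j.1).star.mul
    (continuous_subtype_val.matrix_elem i.2 j.2)

/-- The projection `U(d) → PU(d)` as a continuous map. -/
def toPUMap (d : ℕ) : C(U d, PU d) :=
  ⟨toPU, continuous_channel.subtype_mk _⟩

theorem toPU_surjective (d : ℕ) : Function.Surjective (toPU : U d → PU d) := by
  rintro ⟨_, W, rfl⟩
  exact ⟨W, rfl⟩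

instance compactSpace_PU (d : ℕ) : CompactSpace (PU d) :=
  (toPU_surjective d).compactSpace (toPUMap d).continuous

/-- A unit vector v is completed to a unitary by the orthogonal second column (-v̄₁, v̄₀). -/
theorem exists_evolve_refState (ψ : PureState 2) : ∃ g : U 2, evolve g (refState 2) = ψ := by
  obtain ⟨_, v, hv, rfl⟩ := ψ
  have hv' : v 0 * star (v 0) + v 1 * star (v 1) = 1 := by
    simpa [dotProduct, Fin.sum_univ_two] using hv
  refine ⟨⟨!![v 0, -star (v 1); v 1, star (v 0)], ?_⟩, ?_⟩
  · rw [Matrix.mem_unitaryGroup_iff']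
    ext i j
    fin_cases i <;> fin_cases j <;>
      simp [Matrix.mul_apply, Fin.sum_univ_two, Matrix.star_apply] <;> simp at hv' <;>
      first | linear_combination hv' | ring
  · refine Subtype.ext ?_
    ext i j
    fin_cases i <;> fin_cases j <;>
      simp [evolve, refState, Matrix.mul_vecMulVec, Matrix.vecMulVec_mul, Matrix.vecMulVec_apply,
        Matrix.conjTranspose_apply]

instance compactSpace_pureState_two : CompactSpace (PureState 2) :=
  Function.Surjective.compactSpace (f := evolveMap (refState 2)) (evolveMap _).continuous
    exists_evolve_refState

theorem evolve_mul {d : ℕ} (W g : U d) (ψ : PureState d) :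
    evolve (W * g) ψ = evolve W (evolve g ψ) := by
  refine Subtype.ext ?_
  simp [evolve, Matrix.mul_assoc, Matrix.conjTranspose_mul]

/-- The uniform distribution on states does not depend on the reference state. -/
theorem haarU_map_evolveMap (ψ : PureState 2) :
    (haarU 2).map (evolveMap ψ) = haarState 2 := by
  obtain ⟨g, rfl⟩ := exists_evolve_refState ψ
  -- Moving the base point by g precomposes the orbit map with right translation by g, which
  -- preserves Haar measure.
  have hcomp : ⇑(evolveMap (evolve g (refState 2))) = evolveMap (refState 2) ∘ (· * g) := by
    ext1 W
    exact (evolve_mul W g _).symm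
  rw [hcomp, ← Measure.map_map (evolveMap _).continuous.measurable
    (continuous_mul_const g).measurable, haarU_map_mul_right]
  rfl

theorem continuous_tensorPow {n X : Type} [TopologicalSpace X] {F : X → Matrix n n ℂ}
    (hF : Continuous F) (k : ℕ) (i j : Fin k → n) :
    Continuous fun x => tensorPow k (F x) i j := by
  simp only [tensorPow, Matrix.of_apply]
  exact continuous_finsetProd _ fun a _ => hF.matrix_elem _ _

section

variable {d : ℕ} {V : ℝ → U d} {hV : AEMeasurable V (volume.restrict (Set.Ici (0 : ℝ)))}

/-- An entry of `(W ψ W†)^{⊗k}` as a function of `W`. -/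
def stateMoment (k : ℕ) (ψ : PureState d) (i j : Fin k → Fin d) : C(U d, ℂ) :=
  ⟨fun W => tensorPow k (evolveMap ψ W).1 i j,
    continuous_tensorPow (continuous_subtype_val.comp (evolveMap ψ).continuous) k i j⟩

/-- An entry of `(W* ⊗ W)^{⊗k}` as a function of `W`. -/
def channelMoment (k : ℕ) (i j : Fin k → Fin d × Fin d) : C(U d, ℂ) :=
  ⟨fun W => tensorPow k (toPUMap d W).1 i j,
    continuous_tensorPow (continuous_subtype_val.comp (toPUMap d).continuous) k i j⟩

theorem ue_iff (k : ℕ) :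
    UE k V ↔ ∀ i j, channelMoment k i j ∈ equidistributed V hV :=
  tendsto_timeAverage_iff (toPUMap d) (fun W => tensorPow k W.1)
    (continuous_tensorPow continuous_subtype_val k)

theorem cue_iff : CUE V ↔ ∀ f : C(PU d, ℂ), f.comp (toPUMap d) ∈ equidistributed V hV :=
  temporalEnsembleIs_map_iff (toPUMap d)

theorem toPU_apply (W : U d) (p q : Fin d × Fin d) :
    (toPU W).1 p q = star ((W : Matrix (Fin d) (Fin d) ℂ) p.1 q.1) *
      (W : Matrix (Fin d) (Fin d) ℂ) p.2 q.2 := rfl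

/-- The indices appear as (j, i) because the conjugated factor comes first in `W* ⊗ W`. -/
theorem evolve_apply (W : U d) (ψ : PureState d) (i j : Fin d) :
    (evolve W ψ).1 i j = ∑ y : Fin d × Fin d, ψ.1 y.2 y.1 * (toPU W).1 (j, i) y := by
  simp only [evolve, toPU_apply, Matrix.mul_apply, Matrix.conjTranspose_apply, Finset.sum_mul,
    Fintype.sum_prod_type]
  refine Finset.sum_congr rfl fun y _ => Finset.sum_congr rfl fun x _ => ?_
  ring

/-- The entries of an evolved state are linear in those of the channel. -/
theorem stateMoment_eq_sum (k : ℕ) (ψ : PureState d) (i j : Fin k → Fin d) :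
    stateMoment k ψ i j = ∑ x : Fin k → Fin d × Fin d,
      (∏ a, ψ.1 (x a).2 (x a).1) • channelMoment k (fun a => (j a, i a)) x := by
  ext W
  simp only [stateMoment, channelMoment, ContinuousMap.coe_mk, ContinuousMap.coe_sum,
    Finset.sum_apply, ContinuousMap.smul_apply, smul_eq_mul, tensorPow, Matrix.of_apply]
  simp only [← Finset.prod_mul_distrib]
  rw [← Fintype.piFinset_univ, ← Finset.prod_univ_sum (fun _ => Finset.univ) fun a y =>
    ψ.1 y.2 y.1 * (toPUMap d W).1 (j a, i a) y]
  exact Finset.prod_congr rfl fun a _ => evolve_apply W ψ (i a) (j a)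

/-- The action of `PU(d)` on a state, as a continuous map. -/
def actMap (ψ : PureState d) : C(PU d, PureState d) where
  toFun W := ⟨Matrix.of fun i j => ∑ y : Fin d × Fin d, ψ.1 y.2 y.1 * W.1 (j, i) y, by
    obtain ⟨V, rfl⟩ := toPU_surjective d W
    have h : (Matrix.of fun i j => ∑ y : Fin d × Fin d, ψ.1 y.2 y.1 * (toPU V).1 (j, i) y) =
        (evolve V ψ).1 := by
      ext i j
      exact (evolve_apply V ψ i j).symm
    rw [h]
    exact (evolve V ψ).2⟩
  continuous_toFun := by
    refine Continuous.subtype_mk (continuous_matrix fun i j => ?_) _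
    exact continuous_finsetSum _ fun y _ =>
      continuous_const.mul (continuous_subtype_val.matrix_elem _ _)

theorem actMap_comp_toPUMap (ψ : PureState d) : (actMap ψ).comp (toPUMap d) = evolveMap ψ := by
  ext1 W
  refine Subtype.ext ?_
  ext i j
  exact (evolve_apply W ψ i j).symm

/-! ### Stone–Weierstrass on the projective unitary group -/

/-- An entry of `W^{⊗k}` as a function of `W` in `PU(d)`. -/
def momentPU (k : ℕ) (i j : Fin k → Fin d × Fin d) : C(PU d, ℂ) :=
  ⟨fun W => tensorPow k W.1 i j, continuous_tensorPow continuous_subtype_val k i j⟩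

theorem momentPU_mul {k l : ℕ} (i j : Fin k → Fin d × Fin d) (i' j' : Fin l → Fin d × Fin d) :
    momentPU k i j * momentPU l i' j' = momentPU (k + l) (Fin.append i i') (Fin.append j j') := by
  ext W
  simp [momentPU, tensorPow, Fin.prod_univ_add]

/-- Conjugating `V* ⊗ V` exchanges its two tensor factors. -/
theorem star_momentPU {k : ℕ} (i j : Fin k → Fin d × Fin d) :
    star (momentPU k i j) = momentPU k (fun a => (i a).swap) (fun a => (j a).swap) := by
  ext W
  obtain ⟨V, rfl⟩ := toPU_surjective d W
  simp [momentPU, tensorPow, toPU_apply, mul_comm]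

/-- Stone–Weierstrass: the channel moments span a dense subspace of the continuous functions
on `PU(d)`. -/
theorem span_momentPU_dense (d : ℕ) :
    (Submodule.span ℂ {f : C(PU d, ℂ) | ∃ k i j, f = momentPU k i j}).topologicalClosure = ⊤ := by
  set E : Set C(PU d, ℂ) := {f | ∃ k i j, f = momentPU k i j} with hE
  have hstar : star E ⊆ E := by
    rintro f ⟨k, i, j, hf⟩
    exact ⟨k, _, _, by rw [← star_star f, hf, star_momentPU]⟩
  have hclosure : (Submonoid.closure E : Set C(PU d, ℂ)) ⊆ E := by
    intro f hf
    induction hf using Submonoid.closure_induction with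
    | mem f hf => exact hf
    | one => exact ⟨0, Fin.elim0, Fin.elim0, by ext W; simp [momentPU, tensorPow]⟩
    | mul f g _ _ hf hg =>
      obtain ⟨k, i, j, rfl⟩ := hf
      obtain ⟨l, i', j', rfl⟩ := hg
      exact ⟨_, _, _, momentPU_mul i j i' j'⟩
  -- The moments contain 1 and are closed under products and conjugation, so the star algebra they
  -- generate is just their span.
  have hspan : Subalgebra.toSubmodule (StarAlgebra.adjoin ℂ E).toSubalgebra =
      Submodule.span ℂ E := by
    rw [StarAlgebra.adjoin_toSubalgebra, Set.union_eq_self_of_subset_right hstar,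
      Algebra.adjoin_eq_span]
    exact congrArg _ (hclosure.antisymm Submonoid.subset_closure)
  have hsep : (StarAlgebra.adjoin ℂ E).SeparatesPoints := by
    intro W W' hne
    have : ∃ p q, W.1 p q ≠ W'.1 p q := by
      by_contra! h
      exact hne (Subtype.ext (Matrix.ext h))
    obtain ⟨p, q, hpq⟩ := this
    refine ⟨momentPU 1 (fun _ => p) (fun _ => q),
      ⟨_, StarAlgebra.subset_adjoin ℂ E ⟨1, _, _, rfl⟩, rfl⟩, ?_⟩
    simpa [momentPU, tensorPow] using hpq
  have htop := ContinuousMap.starSubalgebra_topologicalClosure_eq_top_of_separatesPoints _ hsep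
  rw [← hspan]
  refine SetLike.coe_injective ?_
  exact congrArg (SetLike.coe : StarSubalgebra ℂ C(PU d, ℂ) → Set C(PU d, ℂ)) htop

/-- Pullback to `U d` is continuous and S is closed, so it suffices to test the dense span of the
moments. -/
theorem cue_of_forall_ue (hV : AEMeasurable V (volume.restrict (Set.Ici (0 : ℝ))))
    (h : ∀ k, UE k V) : CUE V := by
  refine (cue_iff (hV := hV)).2 fun f => ?_
  let Φ : C(PU d, ℂ) →ₐ[ℂ] C(U d, ℂ) := ContinuousMap.compRightAlgHom ℂ ℂ (toPUMap d)
  have hle : (Submodule.span ℂ {f : C(PU d, ℂ) | ∃ k i j, f = momentPU k i j}).topologicalClosure ≤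
      (equidistributed V hV).comap Φ.toLinearMap := by
    refine Submodule.topologicalClosure_minimal _ (Submodule.span_le.2 ?_)
      ((isClosed_equidistributed (hV := hV)).preimage
        (ContinuousMap.compRightAlgHom_continuous ℂ ℂ _))
    rintro _ ⟨k, i, j, rfl⟩
    exact (ue_iff (hV := hV) k).1 (h k) i j
  rw [span_momentPU_dense] at hle
  exact hle Submodule.mem_top

end

/-! ### Membership criteria for qubit states and the easy implications -/

theorem hse_iff {V : ℝ → U 2} {hV : AEMeasurable V (volume.restrict (Set.Ici (0 : ℝ)))} (k : ℕ) :
    HSE k V ↔ ∀ ψ i j, stateMoment k ψ i j ∈ equidistributed V hV :=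
  forall_congr' fun ψ => by
    rw [← haarU_map_evolveMap ψ]
    exact tendsto_timeAverage_iff (evolveMap ψ) (fun φ => tensorPow k φ.1)
      (continuous_tensorPow continuous_subtype_val k)

theorem chse_iff {V : ℝ → U 2} {hV : AEMeasurable V (volume.restrict (Set.Ici (0 : ℝ)))} :
    CHSE V ↔ ∀ ψ, ∀ f : C(PureState 2, ℂ), f.comp (evolveMap ψ) ∈ equidistributed V hV :=
  forall_congr' fun ψ => by
    rw [← haarU_map_evolveMap ψ]
    exact temporalEnsembleIs_map_iff (evolveMap ψ)

theorem hse_of_ue {V : ℝ → U 2} (hV : AEMeasurable V (volume.restrict (Set.Ici (0 : ℝ)))) {k : ℕ}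
    (h : UE k V) : HSE k V := by
  refine (hse_iff (hV := hV) k).2 fun ψ i j => ?_
  rw [stateMoment_eq_sum]
  exact Submodule.sum_mem _ fun x _ => Submodule.smul_mem _ _ ((ue_iff k).1 h _ _)

theorem chse_of_cue {V : ℝ → U 2} (hV : AEMeasurable V (volume.restrict (Set.Ici (0 : ℝ))))
    (h : CUE V) : CHSE V := by
  refine (chse_iff (hV := hV)).2 fun ψ f => ?_
  rw [← actMap_comp_toPUMap, ← ContinuousMap.comp_assoc]
  exact cue_iff.1 h _

theorem hse_of_chse {V : ℝ → U 2} (hV : AEMeasurable V (volume.restrict (Set.Ici (0 : ℝ))))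
    (h : CHSE V) (k : ℕ) : HSE k V :=
  (hse_iff (hV := hV) k).2 fun ψ i j => chse_iff.1 h ψ
    ⟨fun φ => tensorPow k φ.1 i j, continuous_tensorPow continuous_subtype_val k i j⟩

/-! ### Conjugate entries as cofactors -/

/-- The inverse determinant of a unitary as a continuous function. -/
def invDet : C(U 2, ℂ) := star (entry 0 0 * entry 1 1 - entry 0 1 * entry 1 0)

theorem det_mul_invDet :
    (entry 0 0 * entry 1 1 - entry 0 1 * entry 1 0 : C(U 2, ℂ)) * invDet = 1 := by
  ext W
  have h : star ((W : Matrix (Fin 2) (Fin 2) ℂ).det) * (W : Matrix (Fin 2) (Fin 2) ℂ).det = 1 := by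
    rw [← Matrix.det_conjTranspose, ← Matrix.det_mul]
    rw [show (W : Matrix (Fin 2) (Fin 2) ℂ)ᴴ * (W : Matrix (Fin 2) (Fin 2) ℂ) = 1 from
      Matrix.mem_unitaryGroup_iff'.1 W.2, Matrix.det_one]
  rw [Matrix.det_fin_two, mul_comm] at h
  exact h

/-- Both sides are the inverse of W. For 2 × 2 matrices the cofactors are entries up to sign, so
conjugation keeps monomials monomial, up to the inverse determinant. -/
theorem conjTranspose_eq_adjugate (W : U 2) : (W : Matrix (Fin 2) (Fin 2) ℂ)ᴴ =
    invDet W • (W : Matrix (Fin 2) (Fin 2) ℂ).adjugate := by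
  have h1 : (W : Matrix (Fin 2) (Fin 2) ℂ)ᴴ * (W : Matrix (Fin 2) (Fin 2) ℂ) = 1 :=
    Matrix.mem_unitaryGroup_iff'.1 W.2
  have h2 : (W : Matrix (Fin 2) (Fin 2) ℂ).det * invDet W = 1 := by
    rw [Matrix.det_fin_two]
    exact DFunLike.congr_fun det_mul_invDet W
  calc _ = (invDet W * (W : Matrix (Fin 2) (Fin 2) ℂ).det) • (W : Matrix (Fin 2) (Fin 2) ℂ)ᴴ := by
        rw [mul_comm, h2, one_smul]
    _ = invDet W • ((W : Matrix (Fin 2) (Fin 2) ℂ)ᴴ *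
          ((W : Matrix (Fin 2) (Fin 2) ℂ) * (W : Matrix (Fin 2) (Fin 2) ℂ).adjugate)) := by
        rw [Matrix.mul_adjugate, mul_smul, Matrix.mul_smul, Matrix.mul_one]
    _ = _ := by rw [← Matrix.mul_assoc, h1, Matrix.one_mul]

theorem star_entry_zero_zero : star (entry 0 0 : C(U 2, ℂ)) = entry 1 1 * invDet := by
  ext W
  simpa [Matrix.adjugate_fin_two, entry, mul_comm] using
    congrFun (congrFun (conjTranspose_eq_adjugate W) 0) 0

theorem star_entry_zero_one : star (entry 0 1 : C(U 2, ℂ)) = -entry 1 0 * invDet := by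
  ext W
  simpa [Matrix.adjugate_fin_two, entry, mul_comm] using
    congrFun (congrFun (conjTranspose_eq_adjugate W) 1) 0

theorem star_entry_one_zero : star (entry 1 0 : C(U 2, ℂ)) = -entry 0 1 * invDet := by
  ext W
  simpa [Matrix.adjugate_fin_two, entry, mul_comm] using
    congrFun (congrFun (conjTranspose_eq_adjugate W) 0) 1

theorem star_entry_one_one : star (entry 1 1 : C(U 2, ℂ)) = entry 0 0 * invDet := by
  ext W
  simpa [Matrix.adjugate_fin_two, entry, mul_comm] using
    congrFun (congrFun (conjTranspose_eq_adjugate W) 1) 1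

/-- The monomials of degree `2k` in the entries divided by the `k`-th power of the determinant,
up to scalars. -/
def IsBalancedMonomial (k : ℕ) (f : C(U 2, ℂ)) : Prop :=
  ∃ (γ : ℂ) (a b c d : ℕ), a + b + c + d = 2 * k ∧
    f = γ • (entry 0 0 ^ a * entry 0 1 ^ b * entry 1 0 ^ c * entry 1 1 ^ d * invDet ^ k)

theorem IsBalancedMonomial.mul {k l : ℕ} {f g : C(U 2, ℂ)} (hf : IsBalancedMonomial k f)
    (hg : IsBalancedMonomial l g) : IsBalancedMonomial (k + l) (f * g) := by
  obtain ⟨γ, a, b, c, d, h, rfl⟩ := hf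
  obtain ⟨γ', a', b', c', d', h', rfl⟩ := hg
  refine ⟨γ * γ', a + a', b + b', c + c', d + d', by omega, ?_⟩
  rw [smul_mul_smul_comm]
  congr 1
  ring

theorem exists_entry_eq (i j : Fin 2) : ∃ a b c d : ℕ, a + b + c + d = 1 ∧
    (entry i j : C(U 2, ℂ)) = entry 0 0 ^ a * entry 0 1 ^ b * entry 1 0 ^ c * entry 1 1 ^ d := by
  fin_cases i <;> fin_cases j
  · exact ⟨1, 0, 0, 0, rfl, by simp⟩
  · exact ⟨0, 1, 0, 0, rfl, by simp⟩
  · exact ⟨0, 0, 1, 0, rfl, by simp⟩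
  · exact ⟨0, 0, 0, 1, rfl, by simp⟩

theorem exists_star_entry_eq (i j : Fin 2) : ∃ (γ : ℂ) (i' j' : Fin 2),
    star (entry i j : C(U 2, ℂ)) = γ • (entry i' j' * invDet) := by
  fin_cases i <;> fin_cases j
  · exact ⟨1, 1, 1, by simpa using star_entry_zero_zero⟩
  · exact ⟨-1, 1, 0, by simpa using star_entry_zero_one⟩
  · exact ⟨-1, 0, 1, by simpa using star_entry_one_zero⟩
  · exact ⟨1, 0, 0, by simpa using star_entry_one_one⟩

theorem isBalancedMonomial_star_entry_mul_entry (i j i' j' : Fin 2) :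
    IsBalancedMonomial 1 (star (entry i j) * entry i' j') := by
  obtain ⟨γ, x, y, h⟩ := exists_star_entry_eq i j
  obtain ⟨a, b, c, d, h1, h2⟩ := exists_entry_eq x y
  obtain ⟨a', b', c', d', h1', h2'⟩ := exists_entry_eq i' j'
  refine ⟨γ, a + a', b + b', c + c', d + d', by omega, ?_⟩
  rw [h, h2, h2', smul_mul_assoc]
  congr 1
  ring

theorem channelMoment_eq_prod (k : ℕ) (i j : Fin k → Fin 2 × Fin 2) :
    channelMoment k i j = ∏ a, star (entry (i a).1 (j a).1) * entry (i a).2 (j a).2 := by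
  ext W
  simp only [channelMoment, tensorPow, toPUMap, ContinuousMap.coe_mk, Matrix.of_apply,
    ContinuousMap.coe_prod, Finset.prod_apply]
  rfl

theorem isBalancedMonomial_channelMoment (k : ℕ) (i j : Fin k → Fin 2 × Fin 2) :
    IsBalancedMonomial k (channelMoment k i j) := by
  rw [channelMoment_eq_prod]
  induction k with
  | zero => exact ⟨1, 0, 0, 0, 0, rfl, by simp⟩
  | succ k ih =>
    rw [Fin.prod_univ_castSucc]
    exact (ih _ _).mul (isBalancedMonomial_star_entry_mul_entry _ _ _ _)

theorem exists_prod_eq_pow_mul_pow {M : Type*} [CommMonoid M] {k p q : ℕ} (h : p + q = k) :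
    ∃ i : Fin k → Fin 2, ∀ x : Fin 2 → M, ∏ a, x (i a) = x 0 ^ p * x 1 ^ q := by
  subst h
  exact ⟨Fin.append (fun _ => 0) (fun _ => 1), fun x => by simp [Fin.prod_univ_add]⟩

/-! ### From state moments to channel moments -/

/-- The pure state proportional to `(1, z)`. -/
def affineState (z : ℂ) : PureState 2 :=
  ⟨Matrix.vecMulVec ![((√(1 + Complex.normSq z))⁻¹ : ℝ), ((√(1 + Complex.normSq z))⁻¹ : ℝ) * z]
    (star ![((√(1 + Complex.normSq z))⁻¹ : ℝ), ((√(1 + Complex.normSq z))⁻¹ : ℝ) * z]), _, by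
    have h0 : 0 < 1 + Complex.normSq z := add_pos_of_pos_of_nonneg one_pos (Complex.normSq_nonneg z)
    have h1 : (((√(1 + Complex.normSq z))⁻¹ : ℝ) : ℂ) * ((√(1 + Complex.normSq z))⁻¹ : ℝ) *
        (1 + z * (starRingEnd ℂ) z) = 1 := by
      rw [Complex.mul_conj]
      norm_cast
      rw [← mul_inv, Real.mul_self_sqrt h0.le, inv_mul_cancel₀ h0.ne']
    simp only [Matrix.vec2_dotProduct, Pi.star_apply, Matrix.cons_val_zero, Matrix.cons_val_one,
      star_mul', Complex.star_def, Complex.conj_ofReal]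
    linear_combination h1, rfl⟩

/-- Multiplying by the squared norm removes the normalisation, leaving a polynomial in z and its
conjugate. -/
theorem evolve_affineState_apply (W : U 2) (z : ℂ) (i j : Fin 2) :
    (1 + Complex.normSq z : ℂ) * (evolve W (affineState z)).1 i j =
      (entry i 0 W + z * entry i 1 W) * star (entry j 0 W + z * entry j 1 W) := by
  have h0 : 0 < 1 + Complex.normSq z := add_pos_of_pos_of_nonneg one_pos (Complex.normSq_nonneg z)
  have h1 : (1 + Complex.normSq z : ℂ) * ((((√(1 + Complex.normSq z))⁻¹ : ℝ) : ℂ) *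
      ((√(1 + Complex.normSq z))⁻¹ : ℝ)) = 1 := by
    norm_cast
    rw [← mul_inv, Real.mul_self_sqrt h0.le, mul_inv_cancel₀ h0.ne']
  rw [evolve_apply]
  simp only [Fintype.sum_prod_type, Fin.sum_univ_two, affineState, Matrix.vecMulVec_apply,
    toPU_apply, Pi.star_apply, Matrix.cons_val_zero, Matrix.cons_val_one, star_mul', star_add,
    Complex.star_def, Complex.conj_ofReal, map_mul, entry, ContinuousMap.coe_mk]
  linear_combination ((W.1 i 0 + z * W.1 i 1) * ((starRingEnd ℂ) (W.1 j 0) +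
    (starRingEnd ℂ) z * (starRingEnd ℂ) (W.1 j 1))) * h1

theorem stateProduct_entry_mem {V : ℝ → U 2}
    (hV : AEMeasurable V (volume.restrict (Set.Ici (0 : ℝ)))) {k : ℕ} (h : HSE k V)
    (p q r s : ℕ) (hpq : p + q = k) (hrs : r + s = k) (z : ℂ) :
    stateProduct (entry 0 0) (entry 0 1) (entry 1 0) (entry 1 1) (entry 1 1 * invDet)
      (-entry 1 0 * invDet) (-entry 0 1 * invDet) (entry 0 0 * invDet) p q r s 1 z 1 (star z) ∈
      equidistributed V hV := by
  -- The row multi-index takes p zeros and q ones, the column multi-index r zeros and s ones.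
  obtain ⟨i, hi⟩ := exists_prod_eq_pow_mul_pow (M := ℂ) hpq
  obtain ⟨j, hj⟩ := exists_prod_eq_pow_mul_pow (M := ℂ) hrs
  convert Submodule.smul_mem _ ((1 + Complex.normSq z : ℂ) ^ k)
    ((hse_iff (hV := hV) k).1 h (affineState z) i j) using 1
  rw [← star_entry_zero_zero, ← star_entry_zero_one, ← star_entry_one_zero, ← star_entry_one_one]
  ext W
  have hprod : (1 + Complex.normSq z : ℂ) ^ k * ∏ a, (evolve W (affineState z)).1 (i a) (j a) =
      (∏ a, (entry (i a) 0 W + z * entry (i a) 1 W)) *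
        ∏ a, star (entry (j a) 0 W + z * entry (j a) 1 W) := by
    rw [← Finset.prod_mul_distrib, ← Fin.prod_const, ← Finset.prod_mul_distrib]
    exact Finset.prod_congr rfl fun a _ => evolve_affineState_apply W z (i a) (j a)
  rw [hi fun x => entry x 0 W + z * entry x 1 W,
    hj fun x => star (entry x 0 W + z * entry x 1 W)] at hprod
  refine Eq.trans ?_ hprod.symm
  simp [stateProduct]

theorem ue_of_hse {V : ℝ → U 2} (hV : AEMeasurable V (volume.restrict (Set.Ici (0 : ℝ)))) {k : ℕ}
    (h : HSE k V) : UE k V := by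
  refine (ue_iff (hV := hV) k).2 fun i j => ?_
  obtain ⟨γ, a, b, c, d, habcd, heq⟩ := isBalancedMonomial_channelMoment k i j
  rw [heq]
  exact Submodule.smul_mem _ _ (monomial_mem_of_stateProduct_mem rfl det_mul_invDet
    (stateProduct_entry_mem hV h) habcd)

end QErgodic

end

theorem corollaryA2 (V : ℝ → QErgodic.U 2)
    (hV : AEMeasurable V (volume.restrict (Set.Ici (0 : ℝ)))) :
    (∀ k : ℕ, QErgodic.HSE k V ↔ QErgodic.UE k V) ∧
    ((∀ k : ℕ, QErgodic.HSE k V) ↔ (∀ k : ℕ, QErgodic.UE k V)) ∧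
    (QErgodic.CHSE V ↔ QErgodic.CUE V) := by
  have h : ∀ k : ℕ, QErgodic.HSE k V ↔ QErgodic.UE k V :=
    fun k => ⟨QErgodic.ue_of_hse hV, QErgodic.hse_of_ue hV⟩
  exact ⟨h, forall_congr' h, fun hc => QErgodic.cue_of_forall_ue hV fun k =>
    (h k).1 (QErgodic.hse_of_chse hV hc k), QErgodic.chse_of_cue hV⟩
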